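/- Let $\mu_0,\epsilon_0>0$ and let $\omega\neq 0$ be a real frequency; put $k_0^2=\mu_0\epsilon_0\omega^2$. Let $\delta\epsilon_T,\delta\epsilon_M,\delta\epsilon_R,\sigma_T,\sigma_R:\mathbb R^3\to\mathbb C$ be smooth and compactly supported, and put $$\delta k_T^2=\delta\epsilon_T k_0^2-i\mu_0\omega\sigma_T,\qquad \delta k_M^2=\delta\epsilon_M k_0^2,\qquad \delta k_R^2=\delta\epsilon_R k_0^2-i\mu_0\omega\sigma_R .$$ Assume that $k_j^2:=k_0^2+\delta k_j^2$ has no zeros for $j=T,M,R$. On vector fields ${\bf A}:\mathbb R^3\to\mathbb C^3$ define $$W_j{\bf A}=-\delta k_j^2\,{\bf A}+(\nabla\cdot{\bf A})\,\nabla\ln(k_j^2),\qquad \nabla \ln (k_j^2):=\frac{\nabla k_j^2}{k_j^2},$$ let ${\rm supp}(W_j)$ be the union of the supports of the coefficients $\delta k_j^2$ and $\nabla\ln(k_j^2)$, and consider in $[L^2(\mathbb R^3)]^3$ the operators $$H=-\Delta+W_T+W_M+W_R,\qquad H_T=-\Delta+W_T,\qquad H_R=-\Delta+W_R$$ with domain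 $[H^2(\mathbb R^3)]^3$. Let $\Omega_T,\Omega_M,\Omega_R$ be bounded open sets with ${\rm supp}(W_j)\subset\Omega_j$, and let $r:=1+\max\{{\rm diam}(\Omega_T),{\rm diam}(\Omega_R)\}$. Assume $$r\le \tfrac12\min\{{\rm dist}(\Omega_R,\Omega_M),{\rm dist}(\Omega_T,\Omega_M)\},\qquad r\le\tfrac12{\rm dist}(\Omega_T,\Omega_R),$$ where the distance to the empty set is $\infty$. Let $0\in\Omega_T$ and ${\bf e}\in\Omega_R$. Let $J:\mathbb R^3\to[0,1]$ be smooth with $J({\bf x})=1$ for $|{\bf x}|\le r-1$ and $J({\bf x})=0$ for $|{\bf x}|\ge r$, and put $J_T({\bf x})=J({\bf x})$, $J_R({\bf x})=J({\bf x}-{\bf e})$. Let $\chi_T,\chi_R,\chi_{{\rm supp}(W_R)}$ denote multiplication by the characteristic functions of $\Omega_T,\Omega_R,{\rm supp}(W_R)$, and let $\chi_{T_a},\chi_{R_a}$ denote multiplication by those of the annuli $r-1\le|{\bf x}|\le r$ and $r-1\le|{\bf x}-{\bf e}|\le r$. Then for every $z\in\mathbb C$ in the resolvent sets of $H$, $H_T$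 and $H_R$, the operator $$K_T(z)=[-\Delta,J_T](H_T-z)^{-1}\chi_T$$ is a bounded operator on $[L^2(\mathbb R^3)]^3$, the operator $\chi_R(H_R-z)^{-1}[\Delta,J_R]$, defined on $[H^2(\mathbb R^3)]^3$, has a unique bounded extension $\tilde K_R(z)$ to $[L^2(\mathbb R^3)]^3$, and $$\chi_{{\rm supp}(W_R)}(H-z)^{-1}\chi_T=\chi_{{\rm supp}(W_R)}\,\tilde K_R(z)\,\chi_{R_a}(H-z)^{-1}\chi_{T_a}\,K_T(z)\,\chi_T .$$ -/

import Mathlib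

open MeasureTheory
open scoped ENNReal SchwartzMap

noncomputable section

namespace Maxwell

/-- Configuration space `ℝ³`. -/
abbrev X : Type := EuclideanSpace ℝ (Fin 3)

/-- Values of vector fields, `ℂ³` with its Hermitian norm. -/
abbrev V : Type := EuclideanSpace ℂ (Fin 3)

/-- The Hilbert space `[L²(ℝ³)]³`. -/
abbrev L2 : Type := Lp V 2 (volume : Measure X)

/-! ### Unbounded operators and resolvents -/

section Resolvent

variable {E : Type*} [NormedAddCommGroup E] [NormedSpace ℂ E]

/-- `R` is the bounded, everywhere defined, two-sided inverse of `A - z : D(A) → E`. -/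
def IsResolventAt (A : E →ₗ.[ℂ] E) (z : ℂ) (R : E →L[ℂ] E) : Prop :=
  (∀ f : E, ∃ h : R f ∈ A.domain, A ⟨R f, h⟩ - z • R f = f) ∧
    ∀ u : A.domain, R (A u - z • (u : E)) = u

/-- The resolvent set of the unbounded operator `A`. -/
def resolventSet (A : E →ₗ.[ℂ] E) : Set ℂ :=
  {z | ∃ R : E →L[ℂ] E, IsResolventAt A z R}

open Classical in
/-- The resolvent `(A - z)⁻¹`, meaningful for `z ∈ resolventSet A`, where it is unique. -/
def resolvent (A : E →ₗ.[ℂ] E) (z : ℂ) : E →L[ℂ] E :=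
  if h : ∃ R : E →L[ℂ] E, IsResolventAt A z R then h.choose else 0

end Resolvent

/-! ### Differential operators, first on tempered distributions and then in `[L²(ℝ³)]³` -/

/-- The Sobolev space `[H²(ℝ³)]³`, as a subspace of `[L²(ℝ³)]³`. -/
def H2 : Submodule ℂ L2 where
  carrier := {u | TemperedDistribution.MemSobolev 2 2 (u : 𝓢'(X, V))}
  add_mem' {u v} hu hv := by
    have h := TemperedDistribution.MemSobolev.add hu hv
    simp only [← Lp.toTemperedDistributionCLM_apply] at h ⊢
    simpa only [Set.mem_ofPred_eq, map_add] using h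
  zero_mem' := by
    simp only [Set.mem_ofPred_eq, ← Lp.toTemperedDistributionCLM_apply, map_zero]
    exact TemperedDistribution.memSobolev_fun_zero X V 2 2
  smul_mem' c u hu := by
    have h := TemperedDistribution.MemSobolev.smul c hu
    simp only [← Lp.toTemperedDistributionCLM_apply] at h ⊢
    simpa only [Set.mem_ofPred_eq, map_smul] using h

lemma toTemperedDistribution_injective :
    Function.Injective (Lp.toTemperedDistributionCLM V (volume : Measure X) 2) :=
  LinearMap.ker_eq_bot.mp Lp.ker_toTemperedDistributionCLM_eq_bot

/-- The `u ∈ [H²(ℝ³)]³` for which the distribution `P u` belongs to `[L²(ℝ³)]³`. This is all of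
`[H²(ℝ³)]³` if `P` is a differential expression of order at most two whose coefficients are smooth
and bounded together with all their derivatives. -/
def realizationDomain (P : 𝓢'(X, V) →L[ℂ] 𝓢'(X, V)) : Submodule ℂ L2 where
  carrier := {u | u ∈ H2 ∧ ∃ f : L2, (f : 𝓢'(X, V)) = P (u : 𝓢'(X, V))}
  add_mem' := by
    rintro u v ⟨hu, f, hf⟩ ⟨hv, g, hg⟩
    refine ⟨H2.add_mem hu hv, f + g, ?_⟩
    simp only [← Lp.toTemperedDistributionCLM_apply] at hf hg ⊢
    simp only [map_add, hf, hg]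
  zero_mem' := by
    refine ⟨H2.zero_mem, 0, ?_⟩
    simp only [← Lp.toTemperedDistributionCLM_apply, map_zero]
  smul_mem' := by
    rintro c u ⟨hu, f, hf⟩
    refine ⟨H2.smul_mem c hu, c • f, ?_⟩
    simp only [← Lp.toTemperedDistributionCLM_apply] at hf ⊢
    simp only [map_smul, hf]

/-- The element of `[L²(ℝ³)]³` that represents the distribution `P u`. -/
def realizationFun (P : 𝓢'(X, V) →L[ℂ] 𝓢'(X, V)) (u : realizationDomain P) : L2 :=
  u.2.2.choose

lemma realizationFun_spec (P : 𝓢'(X, V) →L[ℂ] 𝓢'(X, V)) (u : realizationDomain P) :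
    Lp.toTemperedDistributionCLM V volume 2 (realizationFun P u) =
      P (Lp.toTemperedDistributionCLM V volume 2 (u : L2)) :=
  u.2.2.choose_spec

/-- The operator `u ↦ P u` in `[L²(ℝ³)]³` given by a differential expression `P`, with domain
`realizationDomain P`. -/
def realization (P : 𝓢'(X, V) →L[ℂ] 𝓢'(X, V)) : L2 →ₗ.[ℂ] L2 where
  domain := realizationDomain P
  toFun :=
    { toFun := realizationFun P
      map_add' := by
        intro u v
        apply toTemperedDistribution_injective
        rw [realizationFun_spec, map_add, realizationFun_spec, realizationFun_spec,
          Submodule.coe_add, map_add, map_add]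
      map_smul' := by
        intro c u
        apply toTemperedDistribution_injective
        rw [realizationFun_spec, map_smul, realizationFun_spec, Submodule.coe_smul, map_smul,
          map_smul, RingHom.id_apply] }

/-- The Laplacian, acting componentwise on vector-valued distributions. -/
def laplace : 𝓢'(X, V) →L[ℂ] 𝓢'(X, V) := LineDeriv.laplacianCLM ℂ X 𝓢'(X, V)

/-- The divergence `∇ · A` of a vector-valued distribution. -/
def divergence : 𝓢'(X, V) →L[ℂ] 𝓢'(X, ℂ) :=
  ∑ i : Fin 3, PointwiseConvergenceCLM.postcomp 𝓢(X, ℂ) (EuclideanSpace.proj i : V →L[ℂ] ℂ) ∘L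
    LineDeriv.lineDerivOpCLM ℂ 𝓢'(X, V) (EuclideanSpace.single i (1 : ℝ))

/-- The product `a v` of a scalar distribution `a` and a smooth vector field `v`. -/
def smulField (v : X → V) : 𝓢'(X, ℂ) →L[ℂ] 𝓢'(X, V) :=
  ∑ i : Fin 3, PointwiseConvergenceCLM.postcomp 𝓢(X, ℂ)
      (ContinuousLinearMap.toSpanSingleton ℂ (EuclideanSpace.single i (1 : ℂ) : V)) ∘L
    TemperedDistribution.smulLeftCLM ℂ (fun x => v x i)

/-- The field `∇ ln κ = κ⁻¹ ∇κ` for a smooth function `κ` without zeros (no choice of a branch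
of the logarithm is involved). -/
def gradLog (κ : X → ℂ) (x : X) : V :=
  WithLp.toLp 2 fun i => fderiv ℝ κ x (EuclideanSpace.single i (1 : ℝ)) / κ x

/-- The first order operator `W A = -δκ A + (∇ · A) ∇ ln (k₀² + δκ)`; here `δκ` stands for the
perturbation `δk²` of the square `k₀²` of the wave number of free space. -/
def perturbation (k₀sq : ℝ) (δκ : X → ℂ) : 𝓢'(X, V) →L[ℂ] 𝓢'(X, V) :=
  -TemperedDistribution.smulLeftCLM V δκ +
    smulField (gradLog fun x => (k₀sq : ℂ) + δκ x) ∘L divergence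

/-- The support of the operator `perturbation k₀sq δκ`, that is, of its coefficients. -/
def perturbationSupport (k₀sq : ℝ) (δκ : X → ℂ) : Set X :=
  tsupport δκ ∪ tsupport (gradLog fun x => (k₀sq : ℂ) + δκ x)

/-- The operator `-Δ + W` with domain `[H²(ℝ³)]³`. -/
def hamiltonian (W : 𝓢'(X, V) →L[ℂ] 𝓢'(X, V)) : L2 →ₗ.[ℂ] L2 :=
  realization (-laplace + W)

/-- The commutator `[-Δ, J] = -Δ J + J Δ` on `[H²(ℝ³)]³`, where `J` also denotes the operator of
multiplication by the function `J`. -/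
def commLaplace (J : X → ℝ) : L2 →ₗ.[ℂ] L2 :=
  realization
    (-laplace ∘L TemperedDistribution.smulLeftCLM V (fun x => (J x : ℂ)) +
      TemperedDistribution.smulLeftCLM V (fun x => (J x : ℂ)) ∘L laplace)

/-! ### Cutoffs -/

/-- Multiplication by the characteristic function of a measurable set `S`. -/
def cutoff (S : Set X) (hS : MeasurableSet S) : L2 →L[ℂ] L2 :=
  LinearMap.mkContinuous
    { toFun := fun f => ((Lp.memLp f).indicator hS).toLp
      map_add' := by
        intro f g
        rw [← MemLp.toLp_add]
        apply MemLp.toLp_congr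
        filter_upwards [Lp.coeFn_add f g] with x hx
        rw [Pi.add_apply] at hx ⊢
        by_cases h : x ∈ S
        · rw [Set.indicator_of_mem h, Set.indicator_of_mem h, Set.indicator_of_mem h, hx]
        · rw [Set.indicator_of_notMem h, Set.indicator_of_notMem h, Set.indicator_of_notMem h,
            add_zero]
      map_smul' := by
        intro c f
        rw [RingHom.id_apply, ← MemLp.toLp_const_smul]
        apply MemLp.toLp_congr
        filter_upwards [Lp.coeFn_smul c f] with x hx
        rw [Pi.smul_apply] at hx ⊢
        by_cases h : x ∈ S
        · rw [Set.indicator_of_mem h, Set.indicator_of_mem h, hx]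
        · rw [Set.indicator_of_notMem h, Set.indicator_of_notMem h, smul_zero] }
    1
    (by
      intro f
      rw [one_mul]
      apply Lp.norm_le_norm_of_ae_le
      filter_upwards [((Lp.memLp f).indicator hS).coeFn_toLp] with x hx
      rw [LinearMap.coe_mk, AddHom.coe_mk, hx]
      exact norm_indicator_le_norm_self _ _)

/-- The closed spherical annulus `r - 1 ≤ |x - a| ≤ r`. -/
def annulus (a : X) (r : ℝ) : Set X := {x | r - 1 ≤ ‖x - a‖ ∧ ‖x - a‖ ≤ r}

lemma measurableSet_annulus (a : X) (r : ℝ) : MeasurableSet (annulus a r) := by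
  have h : Continuous fun x : X => ‖x - a‖ := by fun_prop
  exact ((isClosed_le continuous_const h).inter (isClosed_le h continuous_const)).measurableSet

lemma measurableSet_perturbationSupport (k₀sq : ℝ) (δκ : X → ℂ) :
    MeasurableSet (perturbationSupport k₀sq δκ) :=
  ((isClosed_tsupport _).union (isClosed_tsupport _)).measurableSet

/-- The distance of two sets, equal to `∞` if one of them is empty. -/
def setDist (A B : Set X) : ℝ≥0∞ := ⨅ x ∈ A, ⨅ y ∈ B, edist x y

/-- `K = [-Δ, J] R χ` on `[L²(ℝ³)]³`. -/
def IsCommResolvent (J : X → ℝ) (R χ K : L2 →L[ℂ] L2) : Prop :=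
  ∀ f : L2, ∃ h : R (χ f) ∈ (commLaplace J).domain, K f = commLaplace J ⟨R (χ f), h⟩

/-- `K` is a bounded extension to `[L²(ℝ³)]³` of the operator `χ R [Δ, J]` on `[H²(ℝ³)]³`. -/
def IsResolventComm (J : X → ℝ) (R χ K : L2 →L[ℂ] L2) : Prop :=
  ∀ u : (commLaplace J).domain, K u = χ (R (-commLaplace J u))

end Maxwell

end

namespace Maxwell

noncomputable section

open scoped LineDeriv Laplacian ContDiff
open TemperedDistribution

/-! Two geometric resolvent identities are combined. Write `g = χ_T f`. The cutoff `J_T` is `1` on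
`Ω_T` and `0` on `Ω_M` and `Ω_R`, so `W J_T = J_T W_T`, where `W` is the full perturbation. Hence
`(H - z) J_T (H_T - z)⁻¹ g = g + K_T g`, that is, `(H - z)⁻¹ g = J_T (H_T - z)⁻¹ g - (H - z)⁻¹ K_T
g`, and the first term vanishes on `supp W_R`. In the same way `W_R J_R = J_R W`; since `K_T g`
lives on the annulus `T_a`, where `J_R = 0`, it follows that `J_R (H - z)⁻¹ K_T g = (H_R - z)⁻¹ [-Δ,
J_R] (H - z)⁻¹ K_T g`. On `supp W_R` the factor `J_R` is `1`, and the two minus signs cancel. Both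
identities are instances of `resolvent_mulL2_add`.

The analytic point is that `[-Δ, J]` has order one, with coefficients supported in an annulus. It
maps `H¹` to `L²`, which bounds `K_T`, and `L²` to `H⁻¹`, which yields the extension `K̃_R`
(`exists_isResolventComm`). All identities are checked for tempered distributions and pulled back to
`L²` by injectivity of the embedding; boundedness comes from the closed graph theorem
(`exists_bounded_lift`). -/

/-! ### Products of distributions with smooth functions of compact support -/

/-- Smooth functions of compact support. -/
def IsTest (a : X → ℂ) : Prop := ContDiff ℝ ∞ a ∧ HasCompactSupport a

/-- The partial derivative `∂ᵢ a`. -/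
def partialDeriv (i : Fin 3) (a : X → ℂ) (x : X) : ℂ :=
  fderiv ℝ a x (EuclideanSpace.single i (1 : ℝ))

namespace IsTest

variable {a b : X → ℂ}

lemma hasTemperateGrowth (ha : IsTest a) : a.HasTemperateGrowth :=
  ha.2.hasTemperateGrowth ha.1

lemma memLp (ha : IsTest a) : MemLp a ∞ (volume : Measure X) :=
  ha.1.continuous.memLp_top_of_hasCompactSupport ha.2 _

lemma partialDeriv (ha : IsTest a) (i : Fin 3) : IsTest (partialDeriv i a) :=
  ⟨(ha.1.fderiv_right (m := ∞) (by simp)).clm_apply contDiff_const,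
    ha.2.fderiv_apply (𝕜 := ℝ) _⟩

lemma mul_left (ha : IsTest a) (hb : ContDiff ℝ ∞ b) : IsTest fun x => b x * a x :=
  ⟨hb.mul ha.1, ha.2.mul_left⟩

lemma sub (ha : IsTest a) (hb : IsTest b) : IsTest fun x => a x - b x :=
  ⟨ha.1.sub hb.1, by simpa only [sub_eq_add_neg] using! ha.2.add hb.2.neg⟩

end IsTest

/-! ### Leibniz rule, commutators with the Laplacian, and Bessel potentials -/

section Leibniz

variable {F : Type*} [NormedAddCommGroup F] [InnerProductSpace ℂ F]

lemma lineDeriv_smulLeft {a : X → ℂ} (ha : IsTest a) (i : Fin 3) (T : 𝓢'(X, F)) :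
    ∂_{(EuclideanSpace.single i (1 : ℝ) : X)} (smulLeftCLM F a T) =
      smulLeftCLM F (partialDeriv i a) T +
        smulLeftCLM F a (∂_{(EuclideanSpace.single i (1 : ℝ) : X)} T) := by
  ext φ
  simp only [lineDerivOp_apply_apply, smulLeftCLM_apply_apply, _root_.add_apply]
  rw [← map_add]
  congr 1
  ext x
  have h : HasFDerivAt (fun y => a y * φ y)
      (a x • fderiv ℝ φ x + (fderiv ℝ a x).smulRight (φ x)) x :=
    (ha.1.differentiable (by simp) x).hasFDerivAt.smul (φ.differentiableAt.hasFDerivAt)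
  have h' : (SchwartzMap.smulLeftCLM ℂ a φ : X → ℂ) = fun y => a y * φ y := by
    ext y; simp [ha.hasTemperateGrowth]
  simp [SchwartzMap.lineDerivOp_apply_eq_fderiv, ha.hasTemperateGrowth,
    (ha.partialDeriv i).hasTemperateGrowth, h', h.fderiv, partialDeriv]

lemma laplacian_eq_sum_single (T : 𝓢'(X, F)) :
    Δ T = ∑ i : Fin 3, ∂_{(EuclideanSpace.single i (1 : ℝ) : X)}
      (∂_{(EuclideanSpace.single i (1 : ℝ) : X)} T) := by
  simpa using laplacian_eq_sum (EuclideanSpace.basisFun (Fin 3) ℝ) T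

/-- The commutator `[-Δ, a]` of distributions. -/
def commDist (a : X → ℂ) (T : 𝓢'(X, F)) : 𝓢'(X, F) :=
  -Δ (smulLeftCLM F a T) + smulLeftCLM F a (Δ T)

/-- Here `T` is differentiated before it is multiplied: the form suited to `T ∈ H¹`, giving a result
in `L²`. -/
lemma commDist_eq {a : X → ℂ} (ha : IsTest a) (T : 𝓢'(X, F)) :
    commDist a T = -∑ i : Fin 3, (smulLeftCLM F (partialDeriv i (partialDeriv i a)) T +
      (2 : ℂ) • smulLeftCLM F (partialDeriv i a)
        (∂_{(EuclideanSpace.single i (1 : ℝ) : X)} T)) := by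
  have h (i : Fin 3) : ∂_{(EuclideanSpace.single i (1 : ℝ) : X)}
      (∂_{(EuclideanSpace.single i (1 : ℝ) : X)} (smulLeftCLM F a T)) =
      (smulLeftCLM F (partialDeriv i (partialDeriv i a)) T +
      (2 : ℂ) • smulLeftCLM F (partialDeriv i a)
        (∂_{(EuclideanSpace.single i (1 : ℝ) : X)} T)) +
        smulLeftCLM F a (∂_{(EuclideanSpace.single i (1 : ℝ) : X)}
          (∂_{(EuclideanSpace.single i (1 : ℝ) : X)} T)) := by
    rw [lineDeriv_smulLeft ha, LineDeriv.lineDerivOp_add, lineDeriv_smulLeft (ha.partialDeriv i),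
      lineDeriv_smulLeft ha, two_smul]
    abel
  rw [commDist, laplacian_eq_sum_single, laplacian_eq_sum_single, map_sum]
  simp only [h, Finset.sum_add_distrib]
  abel

/-- Here the derivative stands outside the product: the form suited to `T` merely in `L²`, giving a
result in `H⁻¹`. -/
lemma commDist_eq' {a : X → ℂ} (ha : IsTest a) (T : 𝓢'(X, F)) :
    commDist a T = ∑ i : Fin 3, (smulLeftCLM F (partialDeriv i (partialDeriv i a)) T -
      (2 : ℂ) • ∂_{(EuclideanSpace.single i (1 : ℝ) : X)}
        (smulLeftCLM F (partialDeriv i a) T)) := by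
  rw [commDist_eq ha, ← Finset.sum_neg_distrib]
  refine Finset.sum_congr rfl fun i _ => ?_
  rw [lineDeriv_smulLeft (ha.partialDeriv i)]
  simp only [two_smul]
  abel

/-- The Fourier transform is normalized with `exp (-2πi x·ξ)`, so `|ξ|²` is the symbol of `-Δ /
4π²`; this is the source of the constant `4π²` below. -/
lemma besselPotential_two (T : 𝓢'(X, F)) :
    besselPotential X F 2 T = T - ((2 * Real.pi : ℝ) ^ 2 : ℂ)⁻¹ • Δ T := by
  have h : (fun x : X => (((1 + ‖x‖ ^ 2) ^ ((2 : ℝ) / 2) : ℝ) : ℂ)) =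
      (fun _ => (1 : ℂ)) + fun x => ((‖x‖ ^ 2 : ℝ) : ℂ) := by
    ext x; simp
  have hp : (((2 * Real.pi : ℝ)) ^ 2 : ℂ) ≠ 0 :=
    pow_ne_zero 2 (Complex.ofReal_ne_zero.2 Real.two_pi_pos.ne')
  have h2 : Δ T = -(((2 * Real.pi : ℝ)) ^ 2 : ℂ) • fourierMultiplierCLM F
      (fun x : X ↦ Complex.ofReal (‖x‖ ^ 2)) T := by
    rw [laplacian_eq_fourierMultiplierCLM, ← Complex.coe_smul]
    push_cast
    rfl
  rw [h2, smul_smul, mul_neg, inv_mul_cancel₀ hp, neg_one_smul, sub_neg_eq_add, besselPotential, h]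
  simp only [fourierMultiplierCLM_apply]
  rw [smulLeftCLM_add (by fun_prop) (by fun_prop)]
  simp [FourierTransform.fourierInv_add]

lemma neg_laplacian_eq (T : 𝓢'(X, F)) :
    -Δ T = ((2 * Real.pi : ℝ) ^ 2 : ℂ) • (besselPotential X F 2 T - T) := by
  have hp : (((2 * Real.pi : ℝ)) ^ 2 : ℂ) ≠ 0 :=
    pow_ne_zero 2 (Complex.ofReal_ne_zero.2 Real.two_pi_pos.ne')
  rw [besselPotential_two, sub_sub_cancel_left, smul_neg, smul_smul, mul_inv_cancel₀ hp, one_smul]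

/-! ### Sobolev regularity -/

variable [CompleteSpace F]

lemma memSobolev_sum {s : ℝ} {f : Fin 3 → 𝓢'(X, F)} (h : ∀ i, MemSobolev s 2 (f i)) :
    MemSobolev s 2 (∑ i, f i) :=
  Finset.sum_induction _ _ (fun _ _ => MemSobolev.add) (memSobolev_fun_zero X F s 2)
    fun i _ => h i

lemma memSobolev_zero_coe (f : Lp F 2 (volume : Measure X)) :
    MemSobolev 0 2 (f : 𝓢'(X, F)) :=
  memSobolev_zero_iff.2 ⟨f, rfl⟩

lemma memSobolev_smulLeft_zero {a : X → ℂ} (ha : IsTest a) {T : 𝓢'(X, F)}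
    (hT : MemSobolev 0 2 T) : MemSobolev 0 2 (smulLeftCLM F a T) := by
  obtain ⟨f, rfl⟩ := memSobolev_zero_iff.1 hT
  rw [← Lp.toTemperedDistribution_smul_eq (r := 2) ha.hasTemperateGrowth ha.memLp]
  exact memSobolev_zero_coe _

lemma memSobolev_lineDeriv_zero {T : 𝓢'(X, F)} (hT : MemSobolev 1 2 T) (m : X) :
    MemSobolev 0 2 (∂_{m} T) := by
  simpa using hT.lineDerivOp (m := m)

lemma memSobolev_commDist_zero {a : X → ℂ} (ha : IsTest a) {T : 𝓢'(X, F)}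
    (hT : MemSobolev 1 2 T) : MemSobolev 0 2 (commDist a T) := by
  rw [commDist_eq ha]
  refine (memSobolev_sum fun i => ?_).neg
  exact (memSobolev_smulLeft_zero ((ha.partialDeriv i).partialDeriv i)
    (hT.mono zero_le_one)).add
      ((memSobolev_smulLeft_zero (ha.partialDeriv i) (memSobolev_lineDeriv_zero hT _)).smul _)

lemma memSobolev_commDist_neg_one {a : X → ℂ} (ha : IsTest a) {T : 𝓢'(X, F)}
    (hT : MemSobolev 0 2 T) : MemSobolev (-1) 2 (commDist a T) := by
  rw [commDist_eq' ha]
  refine memSobolev_sum fun i => ?_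
  have h := (memSobolev_smulLeft_zero (ha.partialDeriv i) hT).lineDerivOp
    (m := EuclideanSpace.single i (1 : ℝ))
  rw [zero_sub] at h
  exact ((memSobolev_smulLeft_zero ((ha.partialDeriv i).partialDeriv i) hT).mono
    (by norm_num)).sub (h.smul _)

lemma memSobolev_two_iff {T : 𝓢'(X, F)} :
    MemSobolev 2 2 T ↔ MemSobolev 0 2 (besselPotential X F 2 T) := by
  simp

/-- `1 - Δ / 4π²` commutes with `a` up to a multiple of `[-Δ, a]`, which costs only one derivative.
-/
lemma memSobolev_smulLeft_two {a : X → ℂ} (ha : IsTest a) {T : 𝓢'(X, F)}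
    (hT : MemSobolev 2 2 T) : MemSobolev 2 2 (smulLeftCLM F a T) := by
  have h : besselPotential X F 2 (smulLeftCLM F a T) =
      smulLeftCLM F a (besselPotential X F 2 T) +
        ((2 * Real.pi : ℝ) ^ 2 : ℂ)⁻¹ • commDist a T := by
    rw [besselPotential_two, besselPotential_two, commDist, map_sub, map_smul, smul_add, smul_neg]
    abel
  rw [memSobolev_two_iff, h]
  exact (memSobolev_smulLeft_zero ha (memSobolev_two_iff.1 hT)).add
    ((memSobolev_commDist_zero ha (hT.mono one_le_two)).smul _)

lemma memSobolev_postcomp_zero {G : Type*} [NormedAddCommGroup G] [InnerProductSpace ℂ G]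
    [CompleteSpace G] (L : F →L[ℂ] G) {T : 𝓢'(X, F)} (hT : MemSobolev 0 2 T) :
    MemSobolev 0 2 (PointwiseConvergenceCLM.postcomp 𝓢(X, ℂ) L T : 𝓢'(X, G)) := by
  obtain ⟨f, rfl⟩ := memSobolev_zero_iff.1 hT
  refine memSobolev_zero_iff.2 ⟨L.compLp f, ?_⟩
  ext φ
  have hi : Integrable (fun x => φ x • f x) (volume : Measure X) :=
    memLp_one_iff_integrable.1 ((Lp.memLp f).smul (φ.memLp 2))
  change L ((f : 𝓢'(X, F)) φ) = _
  rw [Lp.toTemperedDistribution_apply, Lp.toTemperedDistribution_apply,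
    ← L.integral_comp_comm hi]
  refine integral_congr_ae ?_
  filter_upwards [L.coeFn_compLp f] with x hx
  simp [hx]

end Leibniz

/-! ### The perturbations -/

section Perturbation

variable {F : Type*} [NormedAddCommGroup F] [InnerProductSpace ℂ F]

lemma smulLeft_comm {a b : X → ℂ} (ha : IsTest a) (hb : IsTest b) (T : 𝓢'(X, F)) :
    smulLeftCLM F a (smulLeftCLM F b T) = smulLeftCLM F b (smulLeftCLM F a T) := by
  rw [smulLeftCLM_smulLeftCLM_apply hb.hasTemperateGrowth ha.hasTemperateGrowth,
    smulLeftCLM_smulLeftCLM_apply ha.hasTemperateGrowth hb.hasTemperateGrowth, mul_comm]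

lemma smulLeft_smulLeft_eq_zero {a b : X → ℂ} (ha : IsTest a) (hb : IsTest b)
    (h : ∀ x, a x * b x = 0) (T : 𝓢'(X, F)) : smulLeftCLM F b (smulLeftCLM F a T) = 0 := by
  rw [smulLeftCLM_smulLeftCLM_apply ha.hasTemperateGrowth hb.hasTemperateGrowth,
    show a * b = fun _ => 0 from funext h, smulLeftCLM_const, zero_smul]

/-- The coefficients of `perturbation k δ` are smooth and of compact support. -/
def HasTestCoeffs (k : ℝ) (δ : X → ℂ) : Prop :=
  IsTest δ ∧ ∀ i, IsTest fun x => gradLog (fun x => (k : ℂ) + δ x) x i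

/-- The factor `(k + δ)⁻¹` is smooth because `k + δ` has no zeros; compact support is inherited from
`∇δ`. -/
lemma IsTest.hasTestCoeffs {k : ℝ} {δ : X → ℂ} (hδ : IsTest δ) (h0 : ∀ x, (k : ℂ) + δ x ≠ 0) :
    HasTestCoeffs k δ := by
  refine ⟨hδ, fun i => ?_⟩
  have h : (fun x => gradLog (fun x => (k : ℂ) + δ x) x i) =
      fun x => ((k : ℂ) + δ x)⁻¹ * Maxwell.partialDeriv i δ x := by
    ext x
    simp [gradLog, Maxwell.partialDeriv, fderiv_const_add, div_eq_inv_mul]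
  rw [h]
  exact (hδ.partialDeriv i).mul_left ((contDiff_const.add hδ.1).inv h0)

lemma perturbation_apply (k : ℝ) (δ : X → ℂ) (T : 𝓢'(X, V)) :
    perturbation k δ T = -smulLeftCLM V δ T + ∑ i : Fin 3,
      PointwiseConvergenceCLM.postcomp 𝓢(X, ℂ)
        (ContinuousLinearMap.toSpanSingleton ℂ (EuclideanSpace.single i (1 : ℂ) : V))
        (smulLeftCLM ℂ (fun x => gradLog (fun x => (k : ℂ) + δ x) x i) (divergence T)) := by
  simp [perturbation, smulField]

lemma divergence_apply (T : 𝓢'(X, V)) :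
    divergence T = ∑ i : Fin 3, PointwiseConvergenceCLM.postcomp 𝓢(X, ℂ)
      (EuclideanSpace.proj i : V →L[ℂ] ℂ) (∂_{(EuclideanSpace.single i (1 : ℝ) : X)} T) := by
  simp [divergence]

lemma postcomp_smulLeft {G : Type*} [NormedAddCommGroup G] [InnerProductSpace ℂ G]
    (L : F →L[ℂ] G) (a : X → ℂ) (T : 𝓢'(X, F)) :
    PointwiseConvergenceCLM.postcomp 𝓢(X, ℂ) L (smulLeftCLM F a T) =
      smulLeftCLM G a (PointwiseConvergenceCLM.postcomp 𝓢(X, ℂ) L T) := rfl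

lemma memSobolev_zero_perturbation {k : ℝ} {δ : X → ℂ} (hδ : HasTestCoeffs k δ)
    {T : 𝓢'(X, V)} (hT : MemSobolev 1 2 T) : MemSobolev 0 2 (perturbation k δ T) := by
  rw [perturbation_apply]
  refine (memSobolev_smulLeft_zero hδ.1 (hT.mono zero_le_one)).neg.add
    (memSobolev_sum fun i => memSobolev_postcomp_zero _ (memSobolev_smulLeft_zero (hδ.2 i) ?_))
  rw [divergence_apply]
  exact memSobolev_sum fun j => memSobolev_postcomp_zero _ (memSobolev_lineDeriv_zero hT _)

/-- The only obstruction to commuting is the term `∇a · T` in `∇ · (a T)`, and multiplication by `∇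
ln κ` annihilates it. -/
lemma perturbation_smulLeft {k : ℝ} {δ a : X → ℂ} (hδ : HasTestCoeffs k δ) (ha : IsTest a)
    (h : ∀ i j x, partialDeriv j a x * gradLog (fun x => (k : ℂ) + δ x) x i = 0)
    (T : 𝓢'(X, V)) :
    perturbation k δ (smulLeftCLM V a T) = smulLeftCLM V a (perturbation k δ T) := by
  have hd : divergence (smulLeftCLM V a T) = (∑ j : Fin 3, smulLeftCLM ℂ (partialDeriv j a)
      (PointwiseConvergenceCLM.postcomp 𝓢(X, ℂ) (EuclideanSpace.proj j : V →L[ℂ] ℂ) T)) +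
        smulLeftCLM ℂ a (divergence T) := by
    simp only [divergence_apply, lineDeriv_smulLeft ha, map_add, postcomp_smulLeft,
      Finset.sum_add_distrib, map_sum]
  rw [perturbation_apply, perturbation_apply, map_add, map_neg, map_sum, smulLeft_comm hδ.1 ha]
  congr 1
  refine Finset.sum_congr rfl fun i _ => ?_
  rw [hd, map_add, map_sum, Finset.sum_eq_zero, zero_add, smulLeft_comm (hδ.2 i) ha,
    postcomp_smulLeft]
  exact fun j _ => smulLeft_smulLeft_eq_zero (ha.partialDeriv j) (hδ.2 i) (h i j) _

lemma smulLeft_perturbation_eq_zero {k : ℝ} {δ a : X → ℂ} (hδ : HasTestCoeffs k δ)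
    (ha : IsTest a) (h : ∀ x ∈ perturbationSupport k δ, a x = 0) (T : 𝓢'(X, V)) :
    smulLeftCLM V a (perturbation k δ T) = 0 := by
  rw [perturbation_apply, map_add, map_neg, map_sum, smulLeft_smulLeft_eq_zero hδ.1 ha,
    Finset.sum_eq_zero, neg_zero, zero_add]
  · intro i _
    rw [← postcomp_smulLeft, smulLeft_smulLeft_eq_zero (hδ.2 i) ha, map_zero]
    intro x
    by_cases hx : gradLog (fun x => (k : ℂ) + δ x) x = 0
    · simp [hx]
    · rw [h x (Or.inr (subset_tsupport _ hx)), mul_zero]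
  · intro x
    by_cases hx : δ x = 0
    · rw [hx, zero_mul]
    · rw [h x (Or.inl (subset_tsupport _ hx)), mul_zero]

/-- A cutoff that is locally constant near the support of a perturbation commutes with it. -/
lemma perturbation_smulLeft_of_eventuallyEq {k : ℝ} {δ a : X → ℂ} (hδ : HasTestCoeffs k δ)
    (ha : IsTest a) {Ω : Set X} (hΩ : IsOpen Ω) (hsub : perturbationSupport k δ ⊆ Ω) {c : ℂ}
    (h : ∀ x ∈ Ω, a x = c) (T : 𝓢'(X, V)) :
    perturbation k δ (smulLeftCLM V a T) = smulLeftCLM V a (perturbation k δ T) := by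
  refine perturbation_smulLeft hδ ha (fun i j x => ?_) T
  by_cases hx : x ∈ Ω
  · have h' : a =ᶠ[nhds x] fun _ => c := by
      filter_upwards [hΩ.mem_nhds hx] with y hy using h y hy
    rw [partialDeriv, h'.fderiv_eq]
    simp
  · have h' : gradLog (fun x => (k : ℂ) + δ x) x = 0 := by
      by_contra hne
      exact hx (hsub (Or.inr (subset_tsupport _ hne)))
    simp [h']

end Perturbation

/-! ### Operators in `[L²(ℝ³)]³` -/

/-- The embedding of `[L²(ℝ³)]³` into the tempered distributions. -/
abbrev toDist : L2 →L[ℂ] 𝓢'(X, V) := Lp.toTemperedDistributionCLM V volume 2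

lemma memSobolev_toDist (f : L2) : MemSobolev 0 2 (toDist f) := memSobolev_zero_coe f

lemma exists_toDist_eq {T : 𝓢'(X, V)} (hT : MemSobolev 0 2 T) : ∃ f : L2, toDist f = T := by
  obtain ⟨f, hf⟩ := memSobolev_zero_iff.1 hT
  exact ⟨f, hf.symm⟩

/-- By the closed graph theorem, a continuous map from `[L²(ℝ³)]³` to the tempered distributions
with values in `[L²(ℝ³)]³` is bounded. -/
lemma exists_bounded_lift (Q : L2 →L[ℂ] 𝓢'(X, V)) (hQ : ∀ f, MemSobolev 0 2 (Q f)) :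
    ∃ K : L2 →L[ℂ] L2, ∀ f, toDist (K f) = Q f := by
  choose k hk using fun f => exists_toDist_eq (hQ f)
  let K : L2 →ₗ[ℂ] L2 :=
    { toFun := k
      map_add' := fun f g => toTemperedDistribution_injective (by
        rw [map_add]
        exact (hk _).trans (by rw [map_add, ← hk f, ← hk g]))
      map_smul' := fun c f => toTemperedDistribution_injective (by
        rw [map_smul]
        exact (hk _).trans (by rw [map_smul, ← hk f, RingHom.id_apply])) }
  refine ⟨⟨K, K.continuous_of_seq_closed_graph fun u x y hu hy => ?_⟩, hk⟩
  -- The graph is closed because `L²` limits persist in the Hausdorff space of tempered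
  -- distributions, where `Q` is continuous.
  apply toTemperedDistribution_injective
  have h1 := ((toDist.continuous.tendsto y).comp hy)
  have h2 := ((Q.continuous.tendsto x).comp hu)
  refine tendsto_nhds_unique h1 (((hk x).symm ▸ h2 :).congr fun n => ?_)
  exact (hk (u n)).symm

lemma mem_H2_iff {u : L2} : u ∈ H2 ↔ MemSobolev 2 2 (toDist u) := Iff.rfl

lemma toDist_realization (P : 𝓢'(X, V) →L[ℂ] 𝓢'(X, V)) (u : (realization P).domain) :
    toDist (realization P u) = P (toDist u) := realizationFun_spec P u

lemma mem_realization_domain {P : 𝓢'(X, V) →L[ℂ] 𝓢'(X, V)} {u : L2} (hu : u ∈ H2) {f : L2}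
    (hf : toDist f = P (toDist u)) : u ∈ (realization P).domain := ⟨hu, f, hf⟩

lemma laplace_apply (T : 𝓢'(X, V)) : laplace T = Δ T := laplacianCLM_apply T

lemma resolvent_spec {E : Type*} [NormedAddCommGroup E] [NormedSpace ℂ E] {A : E →ₗ.[ℂ] E}
    {z : ℂ} (hz : z ∈ resolventSet A) : IsResolventAt A z (resolvent A z) := by
  have h : ∃ R : E →L[ℂ] E, IsResolventAt A z R := hz
  rw [resolvent, dif_pos h]
  exact h.choose_spec

/-! ### Resolvents in terms of distributional equations -/

section Resolvent

variable {W : 𝓢'(X, V) →L[ℂ] 𝓢'(X, V)} {z : ℂ}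

lemma toDist_hamiltonian (u : (hamiltonian W).domain) :
    toDist (hamiltonian W u) = (-laplace + W) (toDist u) := toDist_realization _ u

lemma resolvent_mem_H2 (hz : z ∈ resolventSet (hamiltonian W)) (f : L2) :
    resolvent (hamiltonian W) z f ∈ H2 :=
  ((resolvent_spec hz).1 f).choose.1

lemma toDist_resolvent (hz : z ∈ resolventSet (hamiltonian W)) (f : L2) :
    -Δ (toDist (resolvent (hamiltonian W) z f)) + W (toDist (resolvent (hamiltonian W) z f)) -
      z • toDist (resolvent (hamiltonian W) z f) = toDist f := by
  obtain ⟨h, hf⟩ := (resolvent_spec hz).1 f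
  have h2 := congrArg toDist hf
  rw [map_sub, map_smul, toDist_hamiltonian] at h2
  rw [← h2]
  simp [laplace_apply]

/-- The equation itself shows that `(-Δ + W) u = f + z u` is in `L²`, so `u` lies in the operator
domain and the left inverse property applies. -/
lemma resolvent_eq (hz : z ∈ resolventSet (hamiltonian W)) {u f : L2} (hu : u ∈ H2)
    (h : -Δ (toDist u) + W (toDist u) - z • toDist u = toDist f) :
    resolvent (hamiltonian W) z f = u := by
  have hP : toDist (f + z • u) = (-laplace + W) (toDist u) := by
    rw [map_add, map_smul, ← h]
    simp [laplace_apply]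
  have hd : u ∈ (hamiltonian W).domain := mem_realization_domain hu hP
  refine Eq.trans (congrArg _ ?_) ((resolvent_spec hz).2 ⟨u, hd⟩)
  apply toTemperedDistribution_injective
  change toDist _ = toDist _
  rw [map_sub, map_smul, toDist_hamiltonian, ← hP, map_add, map_smul]
  exact (add_sub_cancel_right _ _).symm

end Resolvent

/-! ### Bounded operators built from the commutator -/

section Commutator

variable {J : X → ℝ}

lemma toDist_commLaplace (u : (commLaplace J).domain) :
    toDist (commLaplace J u) = commDist (fun x => (J x : ℂ)) (toDist u) := by
  refine (toDist_realization _ u).trans ?_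
  simp [commDist, laplace_apply]

lemma mem_commLaplace_domain (hJ : IsTest fun x => (J x : ℂ)) {u : L2} (hu : u ∈ H2) :
    u ∈ (commLaplace J).domain := by
  obtain ⟨f, hf⟩ := exists_toDist_eq
    (memSobolev_commDist_zero hJ ((mem_H2_iff.1 hu).mono one_le_two))
  refine mem_realization_domain hu (f := f) ?_
  rw [hf]
  simp [commDist, laplace_apply]

/-- The commutator `[-Δ, a]` as a continuous linear map on distributions. -/
def commDistCLM (a : X → ℂ) : 𝓢'(X, V) →L[ℂ] 𝓢'(X, V) :=
  -laplace ∘L smulLeftCLM V a + smulLeftCLM V a ∘L laplace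

lemma commDistCLM_apply (a : X → ℂ) (T : 𝓢'(X, V)) : commDistCLM a T = commDist a T := by
  simp [commDistCLM, commDist, laplace_apply]

lemma exists_isCommResolvent (hJ : IsTest fun x => (J x : ℂ)) {W : 𝓢'(X, V) →L[ℂ] 𝓢'(X, V)}
    {z : ℂ} (hz : z ∈ resolventSet (hamiltonian W)) (χ : L2 →L[ℂ] L2) :
    ∃ K : L2 →L[ℂ] L2, IsCommResolvent J (resolvent (hamiltonian W) z) χ K ∧
      ∀ f, toDist (K f) =
        commDist (fun x => (J x : ℂ)) (toDist (resolvent (hamiltonian W) z (χ f))) := by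
  obtain ⟨K, hK⟩ := exists_bounded_lift
    (commDistCLM (fun x => (J x : ℂ)) ∘L toDist ∘L resolvent (hamiltonian W) z ∘L χ) fun f => by
      simp only [ContinuousLinearMap.comp_apply, commDistCLM_apply]
      exact memSobolev_commDist_zero hJ
        ((mem_H2_iff.1 (resolvent_mem_H2 hz _)).mono one_le_two)
  simp only [ContinuousLinearMap.comp_apply, commDistCLM_apply] at hK
  refine ⟨K, fun f => ⟨mem_commLaplace_domain hJ (resolvent_mem_H2 hz _), ?_⟩, hK⟩
  apply toTemperedDistribution_injective
  rw [toDist_commLaplace]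
  exact hK f

/-- The bounded extension of `χ (H - z)⁻¹ [Δ, J]`, obtained from
`(H - z)⁻¹ = S - (H - z)⁻¹ (W - z - 4π²) S` with `S = (-Δ + 4π²)⁻¹`. -/
lemma exists_isResolventComm (hJ : IsTest fun x => (J x : ℂ)) {W : 𝓢'(X, V) →L[ℂ] 𝓢'(X, V)}
    (hW : ∀ T, MemSobolev 1 2 T → MemSobolev 0 2 (W T))
    {z : ℂ} (hz : z ∈ resolventSet (hamiltonian W)) (χ : L2 →L[ℂ] L2) :
    ∃ K : L2 →L[ℂ] L2, IsResolventComm J (resolvent (hamiltonian W) z) χ K ∧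
      ∀ u v, commDist (fun x => (J x : ℂ)) (toDist u) =
        commDist (fun x => (J x : ℂ)) (toDist v) → K u = K v := by
  set a : X → ℂ := fun x => (J x : ℂ)
  set m : ℂ := ((2 * Real.pi : ℝ) ^ 2 : ℂ) with hm
  have hm0 : m ≠ 0 := pow_ne_zero 2 (Complex.ofReal_ne_zero.2 Real.two_pi_pos.ne')
  -- `S = (-Δ + m)⁻¹` gains two orders: it takes `[-Δ, J] u ∈ H⁻¹` to `H¹`, where the first order
  -- operator `W` still gives `L²`.
  set S : 𝓢'(X, V) →L[ℂ] 𝓢'(X, V) := m⁻¹ • besselPotential X V (-2) with hS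
  have hS1 (u : L2) : MemSobolev 1 2 (S (commDist a (toDist u))) := by
    refine MemSobolev.smul _ (memSobolev_besselPotential_iff.2 ?_)
    have := memSobolev_commDist_neg_one hJ (memSobolev_toDist u)
    norm_num
    exact this
  obtain ⟨A, hA⟩ := exists_bounded_lift (S ∘L commDistCLM a ∘L toDist) fun u => by
    simp only [ContinuousLinearMap.comp_apply, commDistCLM_apply]
    exact (hS1 u).mono zero_le_one
  obtain ⟨B, hB⟩ := exists_bounded_lift
    ((W - (z + m) • ContinuousLinearMap.id ℂ _) ∘L S ∘L commDistCLM a ∘L toDist) fun u => by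
    simp only [ContinuousLinearMap.comp_apply, commDistCLM_apply]
    exact (hW _ (hS1 u)).sub (((hS1 u).mono zero_le_one).smul _)
  simp only [ContinuousLinearMap.comp_apply, commDistCLM_apply] at hA hB
  refine ⟨-(χ ∘L (A - resolvent (hamiltonian W) z ∘L B)), fun u => ?_, fun u v huv => ?_⟩
  · set c := commLaplace J u with hc
    have hcd : toDist c = commDist a (toDist u) := toDist_commLaplace u
    have hb : besselPotential X V 2 (toDist (A u)) = m⁻¹ • toDist c := by
      rw [hA, ← hcd, hS, smul_apply, map_smul,
        besselPotential_besselPotential_apply]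
      simp
    have hA2 : A u ∈ H2 := by
      rw [mem_H2_iff, memSobolev_two_iff, hb]
      exact (memSobolev_toDist c).smul _
    -- `A u = S c` and `B u = (W - z - m) S c`, so `(-Δ + W - z) A u = (-Δ + m) S c + B u = c + B
    -- u`.
    have hR : resolvent (hamiltonian W) z (c + B u) = A u := by
      refine resolvent_eq hz hA2 ?_
      rw [map_add, hB, ← hA, neg_laplacian_eq, hb, smul_sub, smul_smul, ← hm,
        mul_inv_cancel₀ hm0, one_smul]
      simp only [sub_apply, smul_apply, ContinuousLinearMap.id_apply]
      module
    rw [map_neg, map_neg]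
    simp only [neg_apply, ContinuousLinearMap.comp_apply, sub_apply]
    rw [← hR, map_add, add_sub_cancel_right]
  -- `A` and `B` depend on their argument only through its commutator distribution, even outside
  -- `H²`.
  · have h1 : A u = A v := toTemperedDistribution_injective (by
      change toDist _ = toDist _
      rw [hA, hA, huv])
    have h2 : B u = B v := toTemperedDistribution_injective (by
      change toDist _ = toDist _
      rw [hB, hB, huv])
    simp [h1, h2]

/-- Bounded operators that agree on `[H²(ℝ³)]³` are equal. -/
lemma ext_of_H2 {K K' : L2 →L[ℂ] L2} (h : ∀ u ∈ H2, K u = K' u) : K = K' := by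
  have hd := SchwartzMap.denseRange_toLpCLM (F := V) (E := X) (p := 2) (μ := volume)
    (by simp)
  refine ContinuousLinearMap.ext fun u => congrFun (hd.equalizer K.continuous K'.continuous ?_) u
  ext1 φ
  refine h _ (mem_H2_iff.2 ?_)
  change MemSobolev 2 2 (Lp.toTemperedDistribution (φ.toLp 2 volume))
  rw [Lp.toTemperedDistribution_toLp_eq]
  exact φ.memSobolev

end Commutator

/-! ### Multiplication operators -/

/-- Multiplication by a test function in `[L²(ℝ³)]³`. -/
def mulL2 {a : X → ℂ} (ha : IsTest a) (f : L2) : L2 := ha.memLp.toLp a • f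

section Multiplication

variable {a b : X → ℂ}

lemma toDist_mulL2 (ha : IsTest a) (f : L2) :
    toDist (mulL2 ha f) = smulLeftCLM V a (toDist f) :=
  Lp.toTemperedDistribution_smul_eq ha.hasTemperateGrowth ha.memLp f

lemma coeFn_mulL2 (ha : IsTest a) (f : L2) : mulL2 ha f =ᵐ[volume] fun x => a x • f x := by
  filter_upwards [Lp.coeFn_lpSMul (r := 2) (ha.memLp.toLp a) f, ha.memLp.coeFn_toLp] with x h1 h2
  rw [mulL2, h1, Pi.smul_apply', h2]

lemma coeFn_cutoff {S : Set X} (hS : MeasurableSet S) (f : L2) :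
    cutoff S hS f =ᵐ[volume] S.indicator f :=
  ((Lp.memLp f).indicator hS).coeFn_toLp

lemma mulL2_mem_H2 (ha : IsTest a) {u : L2} (hu : u ∈ H2) : mulL2 ha u ∈ H2 := by
  rw [mem_H2_iff, toDist_mulL2]
  exact memSobolev_smulLeft_two ha hu

lemma cutoff_mulL2_eq_zero {S : Set X} (hS : MeasurableSet S) (ha : IsTest a)
    (h : ∀ x ∈ S, a x = 0) (f : L2) : cutoff S hS (mulL2 ha f) = 0 := by
  apply Lp.ext
  filter_upwards [coeFn_cutoff hS (mulL2 ha f), coeFn_mulL2 ha f,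
    Lp.coeFn_zero V 2 (volume : Measure X)] with x h1 h2 h3
  rw [h1, h3]
  by_cases hx : x ∈ S
  · simp [hx, h2, h x hx]
  · simp [hx]

lemma cutoff_mulL2_eq {S : Set X} (hS : MeasurableSet S) (ha : IsTest a)
    (h : ∀ x ∈ S, a x = 1) (f : L2) : cutoff S hS (mulL2 ha f) = cutoff S hS f := by
  apply Lp.ext
  filter_upwards [coeFn_cutoff hS (mulL2 ha f), coeFn_mulL2 ha f, coeFn_cutoff hS f]
    with x h1 h2 h3
  rw [h1, h3]
  by_cases hx : x ∈ S
  · simp [hx, h2, h x hx]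
  · simp [hx]

lemma mulL2_cutoff (ha : IsTest a) {S : Set X} (hS : MeasurableSet S) (f : L2) :
    mulL2 ha (cutoff S hS f) = cutoff S hS (mulL2 ha f) := by
  apply Lp.ext
  filter_upwards [coeFn_cutoff hS (mulL2 ha f), coeFn_mulL2 ha f, coeFn_cutoff hS f,
    coeFn_mulL2 ha (cutoff S hS f)] with x h1 h2 h3 h4
  rw [h1, h4, h3]
  by_cases hx : x ∈ S <;> simp [hx, h2]

lemma cutoff_mulL2_of_support {S : Set X} (hS : MeasurableSet S) (ha : IsTest a)
    (h : ∀ x ∉ S, a x = 0) (f : L2) : cutoff S hS (mulL2 ha f) = mulL2 ha f := by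
  apply Lp.ext
  filter_upwards [coeFn_cutoff hS (mulL2 ha f), coeFn_mulL2 ha f] with x h1 h2
  rw [h1]
  by_cases hx : x ∈ S
  · simp [hx]
  · simp [hx, h2, h x hx]

lemma cutoff_cutoff_of_subset {S S' : Set X} (hS : MeasurableSet S) (hS' : MeasurableSet S')
    (h : S ⊆ S') (f : L2) : cutoff S hS (cutoff S' hS' f) = cutoff S hS f := by
  apply Lp.ext
  filter_upwards [coeFn_cutoff hS (cutoff S' hS' f), coeFn_cutoff hS' f, coeFn_cutoff hS f]
    with x h1 h2 h3
  rw [h1, h3]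
  by_cases hx : x ∈ S
  · simp [hx, h2, h hx]
  · simp [hx]

/-- A sharp cutoff takes `u` out of `H²`, so the form `commDist_eq'` is used: there the derivatives
of `a` multiply `u` before any differentiation. -/
lemma commDist_toDist_cutoff {S : Set X} (hS : MeasurableSet S) (ha : IsTest a)
    (hsupp : ∀ x ∉ S, ∀ i, partialDeriv i a x = 0 ∧ partialDeriv i (partialDeriv i a) x = 0)
    (u : L2) :
    commDist a (toDist (cutoff S hS u)) = commDist a (toDist u) := by
  rw [commDist_eq' ha, commDist_eq' ha]
  refine Finset.sum_congr rfl fun i _ => ?_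
  rw [← toDist_mulL2 (ha.partialDeriv i), ← toDist_mulL2 ((ha.partialDeriv i).partialDeriv i),
    mulL2_cutoff, mulL2_cutoff, cutoff_mulL2_of_support hS _ fun x hx => (hsupp x hx i).1,
    cutoff_mulL2_of_support hS _ fun x hx => (hsupp x hx i).2, toDist_mulL2, toDist_mulL2]

/-- For `u ∈ H²` the form `commDist_eq` exhibits `f` as a sum of `L²` fields multiplied by
derivatives of `a`, which vanish off `S`. -/
lemma cutoff_eq_of_toDist_eq_commDist {S : Set X} (hS : MeasurableSet S) (ha : IsTest a)
    (hsupp : ∀ x ∉ S, ∀ i, partialDeriv i a x = 0 ∧ partialDeriv i (partialDeriv i a) x = 0)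
    {f u : L2} (hu : u ∈ H2)
    (hf : toDist f = commDist a (toDist u)) : cutoff S hS f = f := by
  choose d hd using fun i : Fin 3 => exists_toDist_eq (memSobolev_lineDeriv_zero
    ((mem_H2_iff.1 hu).mono one_le_two) (EuclideanSpace.single i (1 : ℝ)))
  have h : f = -∑ i : Fin 3, (mulL2 ((ha.partialDeriv i).partialDeriv i) u +
      (2 : ℂ) • mulL2 (ha.partialDeriv i) (d i)) := by
    apply toTemperedDistribution_injective
    change toDist _ = toDist _
    rw [hf, commDist_eq ha]
    simp only [map_neg, map_sum, map_add, map_smul, toDist_mulL2, hd]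
  rw [h, map_neg, map_sum]
  congr 1
  refine Finset.sum_congr rfl fun i _ => ?_
  rw [map_add, map_smul, cutoff_mulL2_of_support hS _ fun x hx => (hsupp x hx i).1,
    cutoff_mulL2_of_support hS _ fun x hx => (hsupp x hx i).2]

end Multiplication

/-! ### Localized resolvent identities -/

/-- If `W₁ a = a W₂`, then `(-Δ + W₁ - z) a (-Δ + W₂ - z)⁻¹ = a + [-Δ, a] (-Δ + W₂ - z)⁻¹`. -/
lemma resolvent_mulL2_add {W₁ W₂ : 𝓢'(X, V) →L[ℂ] 𝓢'(X, V)} {a : X → ℂ} (ha : IsTest a)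
    (hW : ∀ T, W₁ (smulLeftCLM V a T) = smulLeftCLM V a (W₂ T)) {z : ℂ}
    (h₁ : z ∈ resolventSet (hamiltonian W₁)) (h₂ : z ∈ resolventSet (hamiltonian W₂))
    {f c : L2} (hc : toDist c = commDist a (toDist (resolvent (hamiltonian W₂) z f))) :
    resolvent (hamiltonian W₁) z (mulL2 ha f + c) =
      mulL2 ha (resolvent (hamiltonian W₂) z f) := by
  refine resolvent_eq h₁ (mulL2_mem_H2 ha (resolvent_mem_H2 h₂ f)) ?_
  rw [map_add, hc, toDist_mulL2, toDist_mulL2, hW, ← toDist_resolvent h₂ f, commDist, map_sub,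
    map_add, map_neg, map_smul]
  abel

/-! ### Radial cutoffs -/

lemma partialDeriv_eventuallyEq_zero {a : X → ℂ} {c : ℂ} {x : X}
    (h : a =ᶠ[nhds x] fun _ => c) (i : Fin 3) : partialDeriv i a =ᶠ[nhds x] fun _ => 0 := by
  filter_upwards [h.fderiv (𝕜 := ℝ)] with y hy
  simp [partialDeriv, hy]

section Cutoff

variable {J : X → ℝ} {r : ℝ}

lemma isTest_translate (hJ : ContDiff ℝ ∞ J) (hJ_zero : ∀ x, r ≤ ‖x‖ → J x = 0) (e : X) :
    IsTest fun x => (J (x - e) : ℂ) := by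
  refine ⟨Complex.ofRealCLM.contDiff.comp (hJ.comp (contDiff_id.sub contDiff_const)),
    HasCompactSupport.intro (isCompact_closedBall e r) fun x hx => ?_⟩
  rw [Metric.mem_closedBall, dist_eq_norm, not_le] at hx
  simp [hJ_zero _ hx.le]

lemma partialDeriv_translate_eq_zero (hJ_one : ∀ x, ‖x‖ ≤ r - 1 → J x = 1)
    (hJ_zero : ∀ x, r ≤ ‖x‖ → J x = 0) (e : X) (x : X) (hx : x ∉ annulus e r) (i : Fin 3) :
    partialDeriv i (fun x => (J (x - e) : ℂ)) x = 0 ∧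
      partialDeriv i (partialDeriv i fun x => (J (x - e) : ℂ)) x = 0 := by
  have hc : Continuous fun x : X => ‖x - e‖ := by fun_prop
  -- The annulus is closed, so off it one strict inequality holds in a neighbourhood and the cutoff
  -- is locally constant.
  have key : ∃ c : ℂ, (fun x => (J (x - e) : ℂ)) =ᶠ[nhds x] fun _ => c := by
    by_cases h1 : r - 1 ≤ ‖x - e‖
    · have h2 : r < ‖x - e‖ := not_le.1 fun h2 => hx ⟨h1, h2⟩
      refine ⟨0, ?_⟩
      filter_upwards [hc.continuousAt.eventually_const_lt h2] with y hy
      simp [hJ_zero _ hy.le]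
    · refine ⟨1, ?_⟩
      filter_upwards [hc.continuousAt.eventually_lt_const (not_le.1 h1)] with y hy
      simp [hJ_one _ hy.le]
  obtain ⟨c, h⟩ := key
  have h1 := partialDeriv_eventuallyEq_zero h i
  exact ⟨h1.eq_of_nhds, (partialDeriv_eventuallyEq_zero h1 i).eq_of_nhds⟩

end Cutoff

lemma two_mul_le_dist_of_le_setDist {A B : Set X} {r : ℝ}
    (h : ENNReal.ofReal r ≤ setDist A B / 2) {x y : X} (hx : x ∈ A) (hy : y ∈ B) :
    2 * r ≤ dist x y := by
  have h1 : setDist A B ≤ edist x y := iInf₂_le_of_le x hx (iInf₂_le y hy)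
  have h2 : ENNReal.ofReal r ≤ ENNReal.ofReal (dist x y / 2) := by
    rw [ENNReal.ofReal_div_of_pos two_pos, ← edist_dist, ENNReal.ofReal_ofNat]
    exact h.trans (ENNReal.div_le_div_right h1 2)
  have h3 := (ENNReal.ofReal_le_ofReal_iff (by positivity)).1 h2
  linarith

/-- Factorization of the localized full resolvent through two cutoffs. -/
theorem cutoff_resolvent_factorization
    {k : ℝ} {δT δM δR : X → ℂ} (hT : HasTestCoeffs k δT) (hM : HasTestCoeffs k δM)
    (hR : HasTestCoeffs k δR) {ΩT ΩM ΩR : Set X} (hΩT : IsOpen ΩT) (hΩM : IsOpen ΩM)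
    (hΩR : IsOpen ΩR) (hsuppT : perturbationSupport k δT ⊆ ΩT)
    (hsuppM : perturbationSupport k δM ⊆ ΩM) (hsuppR : perturbationSupport k δR ⊆ ΩR)
    {JT JR : X → ℝ} (hJT : IsTest fun x => (JT x : ℂ)) (hJR : IsTest fun x => (JR x : ℂ))
    (hTT : ∀ x ∈ ΩT, JT x = 1) (hTM : ∀ x ∈ ΩM, JT x = 0) (hTR : ∀ x ∈ ΩR, JT x = 0)
    (hRT : ∀ x ∈ ΩT, JR x = 0) (hRM : ∀ x ∈ ΩM, JR x = 0) (hRR : ∀ x ∈ ΩR, JR x = 1)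
    {AT AR : Set X} (hAT : MeasurableSet AT) (hAR : MeasurableSet AR)
    (hRA : ∀ x ∈ AT, JR x = 0)
    (hdT : ∀ x ∉ AT, ∀ i, partialDeriv i (fun x => (JT x : ℂ)) x = 0 ∧
      partialDeriv i (partialDeriv i fun x => (JT x : ℂ)) x = 0)
    (hdR : ∀ x ∉ AR, ∀ i, partialDeriv i (fun x => (JR x : ℂ)) x = 0 ∧
      partialDeriv i (partialDeriv i fun x => (JR x : ℂ)) x = 0)
    {z : ℂ} (hz : z ∈ resolventSet (hamiltonian
      (perturbation k δT + perturbation k δM + perturbation k δR)))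
    (hzT : z ∈ resolventSet (hamiltonian (perturbation k δT)))
    (hzR : z ∈ resolventSet (hamiltonian (perturbation k δR))) :
    ∃ KT KR : L2 →L[ℂ] L2,
      IsCommResolvent JT (resolvent (hamiltonian (perturbation k δT)) z)
        (cutoff ΩT hΩT.measurableSet) KT ∧
      IsResolventComm JR (resolvent (hamiltonian (perturbation k δR)) z)
        (cutoff ΩR hΩR.measurableSet) KR ∧
      ∀ f, cutoff _ (measurableSet_perturbationSupport k δR) (resolvent (hamiltonian
          (perturbation k δT + perturbation k δM + perturbation k δR)) z
            (cutoff ΩT hΩT.measurableSet f)) =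
        cutoff _ (measurableSet_perturbationSupport k δR) (KR (cutoff AR hAR
          (resolvent (hamiltonian
            (perturbation k δT + perturbation k δM + perturbation k δR)) z
              (cutoff AT hAT (KT (cutoff ΩT hΩT.measurableSet f)))))) := by
  obtain ⟨KT, hKT, hKT'⟩ := exists_isCommResolvent hJT hzT (cutoff ΩT hΩT.measurableSet)
  obtain ⟨KR, hKR, hKR'⟩ := exists_isResolventComm hJR
    (fun _ => memSobolev_zero_perturbation hR) hzR (cutoff ΩR hΩR.measurableSet)
  refine ⟨KT, KR, hKT, hKR, fun f => ?_⟩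
  set W := perturbation k δT + perturbation k δM + perturbation k δR with hWdef
  set g := cutoff ΩT hΩT.measurableSet f with hg
  set χ := cutoff _ (measurableSet_perturbationSupport k δR)
  -- All three perturbations commute with `J_T`; then `J_T` annihilates those of `M` and `R`.
  have hWT (T) : W (smulLeftCLM V (fun x => (JT x : ℂ)) T) =
      smulLeftCLM V (fun x => (JT x : ℂ)) (perturbation k δT T) := by
    simp only [hWdef, _root_.add_apply]
    rw [perturbation_smulLeft_of_eventuallyEq hT hJT hΩT hsuppT (c := 1),
      perturbation_smulLeft_of_eventuallyEq hM hJT hΩM hsuppM (c := 0),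
      perturbation_smulLeft_of_eventuallyEq hR hJT hΩR hsuppR (c := 0),
      smulLeft_perturbation_eq_zero hM hJT, smulLeft_perturbation_eq_zero hR hJT,
      add_zero, add_zero]
    · exact fun x hx => by simp [hTR x (hsuppR hx)]
    · exact fun x hx => by simp [hTM x (hsuppM hx)]
    · exact fun x hx => by simp [hTR x hx]
    · exact fun x hx => by simp [hTM x hx]
    · exact fun x hx => by simp [hTT x hx]
  have hWR (T) : perturbation k δR (smulLeftCLM V (fun x => (JR x : ℂ)) T) =
      smulLeftCLM V (fun x => (JR x : ℂ)) (W T) := by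
    simp only [hWdef, _root_.add_apply, map_add]
    rw [perturbation_smulLeft_of_eventuallyEq hR hJR hΩR hsuppR (c := 1),
      smulLeft_perturbation_eq_zero hT hJR, smulLeft_perturbation_eq_zero hM hJR,
      zero_add, zero_add]
    · exact fun x hx => by simp [hRM x (hsuppM hx)]
    · exact fun x hx => by simp [hRT x (hsuppT hx)]
    · exact fun x hx => by simp [hRR x hx]
  have hgg : cutoff ΩT hΩT.measurableSet g = g :=
    cutoff_cutoff_of_subset _ _ subset_rfl f
  have hJg : mulL2 hJT g = g := by
    conv_lhs => rw [hg]
    rw [mulL2_cutoff, cutoff_mulL2_eq _ _ fun x hx => by simp [hTT x hx]]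
  set c := KT g
  have hc : toDist c = commDist (fun x => (JT x : ℂ))
      (toDist (resolvent (hamiltonian (perturbation k δT)) z g)) := by
    rw [hKT' g, hgg]
  have hAc : cutoff AT hAT c = c :=
    cutoff_eq_of_toDist_eq_commDist hAT hJT hdT (resolvent_mem_H2 hzT g) hc
  have h1 := congrArg χ (resolvent_mulL2_add hJT hWT hz hzT hc)
  -- On `supp W_R`, where `J_T = 0`, this leaves `χ (H - z)⁻¹ g + χ (H - z)⁻¹ c = 0`.
  rw [hJg, map_add, map_add, cutoff_mulL2_eq_zero _ _ fun x hx => by simp [hTR x (hsuppR hx)]]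
    at h1
  rw [hAc]
  set u := resolvent (hamiltonian W) z c
  have hJc : mulL2 hJR c = 0 := by
    rw [← hAc, mulL2_cutoff, cutoff_mulL2_eq_zero _ _ fun x hx => by simp [hRA x hx]]
  have hu := mem_commLaplace_domain hJR (resolvent_mem_H2 hz c)
  have h2 := resolvent_mulL2_add hJR hWR hzR hz (f := c) (toDist_commLaplace ⟨u, hu⟩)
  rw [hJc, zero_add] at h2
  -- The field `χ_{R_a} u` need not be in `H²`, so the formula for `KR` applies only after the
  -- cutoff is removed; the two fields have the same commutator distribution.
  have h3 : KR (cutoff AR hAR u) = KR u := hKR' _ _ (commDist_toDist_cutoff hAR hJR hdR u)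
  have h4 := hKR ⟨u, hu⟩
  rw [map_neg, h2, map_neg] at h4
  rw [h3, h4, map_neg, cutoff_cutoff_of_subset _ _ hsuppR,
    cutoff_mulL2_eq _ _ fun x hx => by simp [hRR x (hsuppR hx)]]
  exact eq_neg_of_add_eq_zero_left h1

end

end Maxwell

theorem lemma1
    -- the medium, at a fixed frequency
    (μ₀ ε₀ ω : ℝ) (hμ₀ : 0 < μ₀) (hε₀ : 0 < ε₀) (hω : ω ≠ 0)
    (δεT δεM δεR σT σR : Maxwell.X → ℂ)
    (hδεT : ContDiff ℝ (⊤ : ℕ∞) δεT) (hδεM : ContDiff ℝ (⊤ : ℕ∞) δεM) (hδεR : ContDiff ℝ (⊤ : ℕ∞) δεR)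
    (hσT : ContDiff ℝ (⊤ : ℕ∞) σT) (hσR : ContDiff ℝ (⊤ : ℕ∞) σR)
    (hδεT_supp : HasCompactSupport δεT) (hδεM_supp : HasCompactSupport δεM)
    (hδεR_supp : HasCompactSupport δεR)
    (hσT_supp : HasCompactSupport σT) (hσR_supp : HasCompactSupport σR)
    -- the squared wave numbers and their perturbations
    (k₀sq : ℝ) (hk₀sq : k₀sq = μ₀ * ε₀ * ω ^ 2)
    (δκT δκM δκR : Maxwell.X → ℂ)
    (hδκT : δκT = fun x => δεT x * k₀sq - Complex.I * μ₀ * ω * σT x)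
    (hδκM : δκM = fun x => δεM x * k₀sq)
    (hδκR : δκR = fun x => δεR x * k₀sq - Complex.I * μ₀ * ω * σR x)
    (hkT : ∀ x, (k₀sq : ℂ) + δκT x ≠ 0) (hkM : ∀ x, (k₀sq : ℂ) + δκM x ≠ 0)
    (hkR : ∀ x, (k₀sq : ℂ) + δκR x ≠ 0)
    -- the separated regions
    (ΩT ΩM ΩR : Set Maxwell.X)
    (hΩT : IsOpen ΩT) (hΩM : IsOpen ΩM) (hΩR : IsOpen ΩR)
    (hΩT_bdd : Bornology.IsBounded ΩT) (hΩM_bdd : Bornology.IsBounded ΩM)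
    (hΩR_bdd : Bornology.IsBounded ΩR)
    (hsuppT : Maxwell.perturbationSupport k₀sq δκT ⊆ ΩT)
    (hsuppM : Maxwell.perturbationSupport k₀sq δκM ⊆ ΩM)
    (hsuppR : Maxwell.perturbationSupport k₀sq δκR ⊆ ΩR)
    (r : ℝ) (hr : r = 1 + max (Metric.diam ΩT) (Metric.diam ΩR))
    (hsep_M : ENNReal.ofReal r ≤ min (Maxwell.setDist ΩR ΩM) (Maxwell.setDist ΩT ΩM) / 2)
    (hsep_TR : ENNReal.ofReal r ≤ Maxwell.setDist ΩT ΩR / 2)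
    (h0 : (0 : Maxwell.X) ∈ ΩT) (e : Maxwell.X) (he : e ∈ ΩR)
    -- the smooth cutoff
    (J : Maxwell.X → ℝ) (hJ : ContDiff ℝ (⊤ : ℕ∞) J) (hJ01 : ∀ x, 0 ≤ J x ∧ J x ≤ 1)
    (hJ_one : ∀ x, ‖x‖ ≤ r - 1 → J x = 1) (hJ_zero : ∀ x, r ≤ ‖x‖ → J x = 0)
    -- the full, transmitter and receiver operators, and the spectral parameter
    (H HT HR : Maxwell.L2 →ₗ.[ℂ] Maxwell.L2)
    (hH : H = Maxwell.hamiltonian (Maxwell.perturbation k₀sq δκT +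
      Maxwell.perturbation k₀sq δκM + Maxwell.perturbation k₀sq δκR))
    (hHT : HT = Maxwell.hamiltonian (Maxwell.perturbation k₀sq δκT))
    (hHR : HR = Maxwell.hamiltonian (Maxwell.perturbation k₀sq δκR))
    (z : ℂ) (hz : z ∈ Maxwell.resolventSet H) (hzT : z ∈ Maxwell.resolventSet HT)
    (hzR : z ∈ Maxwell.resolventSet HR)
    -- the characteristic functions
    (χT χR χTa χRa χsuppR : Maxwell.L2 →L[ℂ] Maxwell.L2)
    (hχT : χT = Maxwell.cutoff ΩT hΩT.measurableSet)
    (hχR : χR = Maxwell.cutoff ΩR hΩR.measurableSet)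
    (hχTa : χTa = Maxwell.cutoff (Maxwell.annulus 0 r) (Maxwell.measurableSet_annulus 0 r))
    (hχRa : χRa = Maxwell.cutoff (Maxwell.annulus e r) (Maxwell.measurableSet_annulus e r))
    (hχsuppR : χsuppR = Maxwell.cutoff (Maxwell.perturbationSupport k₀sq δκR)
      (Maxwell.measurableSet_perturbationSupport k₀sq δκR)) :
    ∃ KT KRtilde : Maxwell.L2 →L[ℂ] Maxwell.L2,
      -- `KT = [-Δ, J_T] (H_T - z)⁻¹ χ_T`
      Maxwell.IsCommResolvent J (Maxwell.resolvent HT z) χT KT ∧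
      -- `KRtilde` is the only bounded extension of `χ_R (H_R - z)⁻¹ [Δ, J_R]`
      Maxwell.IsResolventComm (fun x => J (x - e)) (Maxwell.resolvent HR z) χR KRtilde ∧
      (∀ K, Maxwell.IsResolventComm (fun x => J (x - e)) (Maxwell.resolvent HR z) χR K →
        K = KRtilde) ∧
      χsuppR ∘L Maxwell.resolvent H z ∘L χT =
        χsuppR ∘L KRtilde ∘L χRa ∘L Maxwell.resolvent H z ∘L χTa ∘L KT ∘L χT := by
  have hmem (c d : ℂ) {a b : Maxwell.X → ℂ} (ha : Maxwell.IsTest a) (hb : Maxwell.IsTest b) :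
      Maxwell.IsTest fun x => a x * c - d * b x := by
    have h1 := ha.mul_left (b := fun _ => c) contDiff_const
    simp only [mul_comm c] at h1
    exact h1.sub (hb.mul_left (b := fun _ => d) contDiff_const)
  have hcT : Maxwell.HasTestCoeffs k₀sq δκT :=
    Maxwell.IsTest.hasTestCoeffs (hδκT ▸ hmem _ _ ⟨hδεT, hδεT_supp⟩ ⟨hσT, hσT_supp⟩) hkT
  have hcR : Maxwell.HasTestCoeffs k₀sq δκR :=
    Maxwell.IsTest.hasTestCoeffs (hδκR ▸ hmem _ _ ⟨hδεR, hδεR_supp⟩ ⟨hσR, hσR_supp⟩) hkR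
  have hcM : Maxwell.HasTestCoeffs k₀sq δκM := by
    refine Maxwell.IsTest.hasTestCoeffs ?_ hkM
    -- There is no conductivity in `M`: the second coefficient is `0`, and its function is a dummy.
    simpa [hδκM] using hmem k₀sq 0 ⟨hδεM, hδεM_supp⟩ ⟨hδεM, hδεM_supp⟩
  have hr1 : 1 ≤ r := by
    rw [hr]
    linarith [Metric.diam_nonneg (s := ΩT), le_max_left (Metric.diam ΩT) (Metric.diam ΩR)]
  have hRM := hsep_M.trans (ENNReal.div_le_div_right (min_le_left _ _) 2)
  have hTM := hsep_M.trans (ENNReal.div_le_div_right (min_le_right _ _) 2)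
  have hJT_far (x : Maxwell.X) (hx : 2 * r ≤ dist 0 x) : J x = 0 :=
    hJ_zero x (by rw [dist_zero_left] at hx; linarith)
  have hJR_far (x : Maxwell.X) (hx : 2 * r ≤ dist e x) : J (x - e) = 0 :=
    hJ_zero _ (by rw [dist_comm, dist_eq_norm] at hx; linarith)
  have he0 := Maxwell.two_mul_le_dist_of_le_setDist hsep_TR h0 he
  subst hH hHT hHR hχT hχR hχTa hχRa hχsuppR
  obtain ⟨KT, KR, hKT, hKR, hfac⟩ := Maxwell.cutoff_resolvent_factorization hcT hcM hcR hΩT hΩM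
    hΩR hsuppT hsuppM hsuppR (JT := J) (JR := fun x => J (x - e))
    (by simpa using Maxwell.isTest_translate hJ hJ_zero 0) (Maxwell.isTest_translate hJ hJ_zero e)
    -- As `0 ∈ Ω_T`, every `x ∈ Ω_T` has `|x| ≤ diam Ω_T ≤ r - 1`.
    (fun x hx => hJ_one x <| by
      have h := Metric.dist_le_diam_of_mem hΩT_bdd hx h0
      rw [dist_zero_right] at h
      linarith [le_max_left (Metric.diam ΩT) (Metric.diam ΩR)])
    (fun x hx => hJT_far x (Maxwell.two_mul_le_dist_of_le_setDist hTM h0 hx))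
    (fun x hx => hJT_far x (Maxwell.two_mul_le_dist_of_le_setDist hsep_TR h0 hx))
    (fun x hx => hJR_far x (by
      rw [dist_comm]
      exact Maxwell.two_mul_le_dist_of_le_setDist hsep_TR hx he))
    (fun x hx => hJR_far x (Maxwell.two_mul_le_dist_of_le_setDist hRM he hx))
    (fun x hx => hJ_one _ <| by
      have h := Metric.dist_le_diam_of_mem hΩR_bdd hx he
      rw [dist_eq_norm] at h
      linarith [le_max_right (Metric.diam ΩT) (Metric.diam ΩR)])
    (Maxwell.measurableSet_annulus 0 r) (Maxwell.measurableSet_annulus e r)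
    -- On `T_a`, `|x - e| ≥ |e| - |x| ≥ 2r - r = r`, so `J_R` vanishes there.
    (fun x hx => hJ_zero _ <| by
      have h := dist_triangle 0 x e
      have h' := hx.2
      rw [sub_zero] at h'
      rw [dist_zero_left x, dist_eq_norm x e] at h
      linarith)
    (by simpa using Maxwell.partialDeriv_translate_eq_zero hJ_one hJ_zero 0)
    (Maxwell.partialDeriv_translate_eq_zero hJ_one hJ_zero e) hz hzT hzR
  refine ⟨KT, KR, hKT, hKR, fun K hK => Maxwell.ext_of_H2 fun u hu => ?_,
    ContinuousLinearMap.ext hfac⟩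
  have hd := Maxwell.mem_commLaplace_domain (Maxwell.isTest_translate hJ hJ_zero e) hu
  exact (hK ⟨u, hd⟩).trans (hKR ⟨u, hd⟩).symm
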